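/- Let $(\mathcal A,\otimes,k)$ be a bicomplete abelian category with a closed symmetric monoidal structure, and let $\mathcal P$ be a reduced symmetric operad in $\mathcal A$, i.e. $\mathcal P_0=0$ and the unit $k\to\mathcal P_1$ is an isomorphism. A reflexive graph of $\mathcal P$-algebras consists of morphisms of $\mathcal P$-algebras $s,t:E\rightrightarrows B$ and $i:B\to E$ with $si=ti=\mathrm{Id}_B$; a morphism of reflexive graphs is a morphism of diagrams. An internal category structure on it is a morphism of $\mathcal P$-algebras $\circ: E\times_{s,t}E\to E$, $(g,f)\mapsto g\circ f$ (defined where $sg=tf$), such that $s(g\circ f)=s(f)$, $t(g\circ f)=t(g)$, which is associative and for which $i$ gives the identities. The category $\mathrm{Cat}(\mathcal P\text{-}alg)$ has as objects the reflexive graphs equipped with an internal category structure, and as morphisms the morphisms of reflexive graphs that commute with the compositions. A reflexive graph satisfies the $\mathrm{Cat}^1$-condition if for every $n\ge 2$ the composite $$\mathcal P_n\otimes\big(\ker(s)\otimes\ker(t)\otimes E^{\otimes (n-2)}\big)\longrightarrow \mathcal P_n\otimes E^{\otimes n}\longrightarrow E$$ of the map induced by the inclusions of the kernels with the structure map of $E$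 is zero. $\mathrm{Cat}^1(\mathcal P\text{-}alg)$ is the full subcategory of the category of reflexive graphs of $\mathcal P$-algebras on those that satisfy the $\mathrm{Cat}^1$-condition. Theorem. A reflexive graph of $\mathcal P$-algebras admits at most one internal category structure, and it admits one if and only if it satisfies the $\mathrm{Cat}^1$-condition. Moreover, the identity on reflexive graphs and on their morphisms defines an isomorphism of categories $\mathrm{Cat}^1(\mathcal P\text{-}alg)\cong \mathrm{Cat}(\mathcal P\text{-}alg)$: there are mutually inverse functors between the two categories that commute (strictly) with the inclusion of $\mathrm{Cat}^1(\mathcal P\text{-}alg)$ in, and the forgetful functor of $\mathrm{Cat}(\mathcal P\text{-}alg)$ to, the category of reflexive graphs. -/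

import Mathlib

open CategoryTheory Limits MonoidalCategory

universe v u

/-! ### Tensor powers in a symmetric monoidal category -/

section TensorPowers

variable {A : Type u} [Category.{v} A] [MonoidalCategory A]

/-- The tensor power `X ^ ⊗ n = (((𝟙 ⊗ X) ⊗ X) ⊗ ⋯) ⊗ X`. -/
@[reducible]
def tpow (X : A) : ℕ → A
  | 0 => 𝟙_ A
  | n + 1 => tpow X n ⊗ X

/-- Functoriality of tensor powers. -/
def tpowMap {X Y : A} (f : X ⟶ Y) : ∀ n : ℕ, tpow X n ⟶ tpow Y n
  | 0 => 𝟙 (𝟙_ A)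
  | n + 1 => tpowMap f n ⊗ₘ f

theorem tpowMap_id (X : A) : ∀ n : ℕ, tpowMap (𝟙 X) n = 𝟙 (tpow X n)
  | 0 => rfl
  | n + 1 => by
    rw [tpowMap, tpowMap_id X n]
    exact id_tensorHom_id _ _

theorem tpowMap_comp {X Y Z : A} (f : X ⟶ Y) (g : Y ⟶ Z) :
    ∀ n : ℕ, tpowMap (f ≫ g) n = tpowMap f n ≫ tpowMap g n
  | 0 => (Category.id_comp (𝟙 (𝟙_ A))).symm
  | n + 1 => by
    rw [tpowMap, tpowMap, tpowMap, tpowMap_comp f g n]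
    exact (tensorHom_comp_tensorHom _ _ _ _).symm

/-- The canonical isomorphism `X ^ ⊗ (a + m) ≅ X ^ ⊗ a ⊗ X ^ ⊗ m`. -/
def tpowSplit (X : A) (a : ℕ) : ∀ m : ℕ, tpow X (a + m) ≅ tpow X a ⊗ tpow X m
  | 0 => (ρ_ (tpow X a)).symm
  | m + 1 => whiskerRightIso (tpowSplit X a m) X ≪≫ α_ (tpow X a) (tpow X m) X

theorem tpowSplit_naturality {X Y : A} (f : X ⟶ Y) (a : ℕ) : ∀ m : ℕ,
    tpowMap f (a + m) ≫ (tpowSplit Y a m).hom =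
      (tpowSplit X a m).hom ≫ (tpowMap f a ⊗ₘ tpowMap f m)
  | 0 => by
    have : tpowMap f 0 = 𝟙 (𝟙_ A) := rfl
    simp only [tpowSplit, this, Nat.add_zero, Iso.symm_hom]
    erw [tensorHom_id]
    exact rightUnitor_inv_naturality _
  | m + 1 => by
    have ih := tpowSplit_naturality f a m
    have h1 : tpowMap f (a + (m + 1)) = tpowMap f (a + m) ⊗ₘ f := rfl
    have h2 : tpowMap f (m + 1) = tpowMap f m ⊗ₘ f := rfl
    simp only [tpowSplit, h1, h2, Iso.trans_hom, whiskerRightIso_hom]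
    have key : (tpowMap f (a + m) ⊗ₘ f) ≫ (tpowSplit Y a m).hom ▷ Y =
        (tpowSplit X a m).hom ▷ X ≫ ((tpowMap f a ⊗ₘ tpowMap f m) ⊗ₘ f) := by
      rw [← tensorHom_id, ← tensorHom_id, tensorHom_comp_tensorHom, tensorHom_comp_tensorHom, ih]
      simp
    calc _ = ((tpowMap f (a + m) ⊗ₘ f) ≫ (tpowSplit Y a m).hom ▷ Y) ≫ (α_ _ _ _).hom :=
          (Category.assoc _ _ _).symm
      _ = (tpowSplit X a m).hom ▷ X ≫ ((tpowMap f a ⊗ₘ tpowMap f m) ⊗ₘ f) ≫ (α_ _ _ _).hom := by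
          rw [key, Category.assoc]
      _ = _ := by
          rw [associator_naturality]
          exact (Category.assoc _ _ _).symm

variable [SymmetricCategory A]

/-- The isomorphism `X ^ ⊗ n ⊗ X ⟶ X ^ ⊗ (n + 1)` that puts the last factor at position `k`
and keeps the order of the other ones. -/
def tpowInsert (X : A) : ∀ (n : ℕ) (_ : Fin (n + 1)), tpow X n ⊗ X ⟶ tpow X (n + 1)
  | 0, _ => 𝟙 _
  | n + 1, k =>
    Fin.lastCases (motive := fun _ => tpow X (n + 1) ⊗ X ⟶ tpow X (n + 2)) (𝟙 _)
      (fun k' => (α_ (tpow X n) X X).hom ≫ tpow X n ◁ (β_ X X).hom ≫ (α_ (tpow X n) X X).inv ≫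
        tpowInsert X n k' ▷ X) k

/-- The bijection between the inputs other than the last one and the remaining outputs. -/
def restrictEquiv {m n : ℕ} (e : Fin (m + 1) ≃ Fin (n + 1)) : Fin m ≃ Fin n :=
  Equiv.removeNone (finSuccEquivLast.symm.trans (e.trans (finSuccEquiv' (e (Fin.last m)))))

/-- The action of a bijection `e` on tensor powers: the `j`-th factor of the source goes to the
factor number `e j` of the target. -/
def tpowPerm (X : A) : ∀ {m n : ℕ} (_ : Fin m ≃ Fin n), tpow X m ⟶ tpow X n
  | 0, 0, _ => 𝟙 _
  | 0, _ + 1, e => (e.symm 0).elim0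
  | _ + 1, 0, e => (e 0).elim0
  | m + 1, n + 1, e => tpowPerm X (restrictEquiv e) ▷ X ≫ tpowInsert X n (e (Fin.last m))

/-- Given `f : Q ⊗ X ^ ⊗ m ⟶ X`, the morphism `Q ⊗ X ^ ⊗ (a + m + b) ⟶ X ^ ⊗ (a + 1 + b)` which
applies `f` to `Q` and the `m` consecutive factors that follow the first `a` ones:
`(q, x₁, …, xₐ, y₁, …, yₘ, z₁, …, z_b) ↦ (x₁, …, xₐ, f (q, y₁, …, yₘ), z₁, …, z_b)`. -/
def plug {Q X : A} (a m : ℕ) (f : Q ⊗ tpow X m ⟶ X) :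
    ∀ b : ℕ, Q ⊗ tpow X (a + m + b) ⟶ tpow X (a + 1 + b)
  | 0 => Q ◁ (tpowSplit X a m).hom ≫ (α_ Q (tpow X a) (tpow X m)).inv ≫
      (β_ Q (tpow X a)).hom ▷ tpow X m ≫ (α_ (tpow X a) Q (tpow X m)).hom ≫ tpow X a ◁ f
  | b + 1 => (α_ Q (tpow X (a + m + b)) X).inv ≫ plug a m f b ▷ X

theorem tpowInsert_naturality {X Y : A} (f : X ⟶ Y) : ∀ (n : ℕ) (k : Fin (n + 1)),
    (tpowMap f n ⊗ₘ f) ≫ tpowInsert Y n k = tpowInsert X n k ≫ tpowMap f (n + 1)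
  | 0, _ => (Category.comp_id _).trans (Category.id_comp _).symm
  | n + 1, k => by
    induction k using Fin.lastCases with
    | last =>
      simp only [tpowInsert, Fin.lastCases_last]
      exact (Category.comp_id _).trans (Category.id_comp _).symm
    | cast k' =>
      simp only [tpowInsert, Fin.lastCases_castSucc]
      have ih := tpowInsert_naturality f n k'
      have h1 : tpowMap f (n + 1) = tpowMap f n ⊗ₘ f := rfl
      have h2 : tpowMap f (n + 1 + 1) = tpowMap f (n + 1) ⊗ₘ f := rfl
      rw [h2, Category.assoc, Category.assoc, Category.assoc]
      have h3 : tpowInsert X n k' ▷ X ≫ (tpowMap f (n + 1) ⊗ₘ f) =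
          ((tpowMap f n ⊗ₘ f) ⊗ₘ f) ≫ tpowInsert Y n k' ▷ Y := by
        rw [← tensorHom_id, ← tensorHom_id, tensorHom_comp_tensorHom, tensorHom_comp_tensorHom, ih]
        simp
      refine Eq.trans ?_ (congrArg (fun z => (α_ (tpow X n) X X).hom ≫ tpow X n ◁ (β_ X X).hom ≫
        (α_ (tpow X n) X X).inv ≫ z) h3.symm)
      rw [h1]
      have h4 : (tpowMap f n ⊗ₘ (f ⊗ₘ f)) ≫ tpow Y n ◁ (β_ Y Y).hom =
          tpow X n ◁ (β_ X X).hom ≫ (tpowMap f n ⊗ₘ (f ⊗ₘ f)) := by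
        rw [← id_tensorHom, ← id_tensorHom, tensorHom_comp_tensorHom, tensorHom_comp_tensorHom,
          BraidedCategory.braiding_naturality]
        simp
      have h5 := associator_naturality (tpowMap f n) f f
      have h6 := associator_inv_naturality (tpowMap f n) f f
      rw [← reassoc_of% h6, ← reassoc_of% h4, ← reassoc_of% h5]

theorem tpowPerm_naturality {X Y : A} (f : X ⟶ Y) : ∀ {m n : ℕ} (e : Fin m ≃ Fin n),
    tpowMap f m ≫ tpowPerm Y e = tpowPerm X e ≫ tpowMap f n
  | 0, 0, _ => (Category.comp_id _).trans (Category.id_comp _).symm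
  | 0, _ + 1, e => (e.symm 0).elim0
  | _ + 1, 0, e => (e 0).elim0
  | m + 1, n + 1, e => by
    have ih := tpowPerm_naturality f (restrictEquiv e)
    have h := tpowInsert_naturality f n (e (Fin.last m))
    have h1 : tpowMap f (m + 1) = tpowMap f m ⊗ₘ f := rfl
    simp only [tpowPerm, h1, Category.assoc]
    rw [← h]
    have h3 : tpowPerm X (restrictEquiv e) ▷ X ≫ (tpowMap f n ⊗ₘ f) =
        (tpowMap f m ⊗ₘ f) ≫ tpowPerm Y (restrictEquiv e) ▷ Y := by
      rw [← tensorHom_id, ← tensorHom_id, tensorHom_comp_tensorHom, tensorHom_comp_tensorHom, ih]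
      simp
    exact (Category.assoc _ _ _).symm.trans
      ((congrArg (· ≫ tpowInsert Y n (e (Fin.last m))) h3.symm).trans (Category.assoc _ _ _))

theorem plug_naturality {Q X Y : A} (a m : ℕ) (f : Q ⊗ tpow X m ⟶ X) (g : Q ⊗ tpow Y m ⟶ Y)
    (h : X ⟶ Y) (w : Q ◁ tpowMap h m ≫ g = f ≫ h) : ∀ b : ℕ,
    Q ◁ tpowMap h (a + m + b) ≫ plug a m g b = plug a m f b ≫ tpowMap h (a + 1 + b)
  | 0 => by
    have h1 : tpowMap h (a + 1 + 0) = tpowMap h a ⊗ₘ h := rfl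
    have h2 : tpow X a ◁ f ≫ (tpowMap h a ⊗ₘ h) =
        (tpowMap h a ⊗ₘ (Q ◁ tpowMap h m)) ≫ tpow Y a ◁ g := by
      rw [← id_tensorHom (tpow X a), ← id_tensorHom (tpow Y a), tensorHom_comp_tensorHom,
        tensorHom_comp_tensorHom, w]
      simp
    have h3 : (α_ (tpow X a) Q (tpow X m)).hom ≫ (tpowMap h a ⊗ₘ (Q ◁ tpowMap h m)) =
        ((tpowMap h a ▷ Q) ⊗ₘ tpowMap h m) ≫ (α_ (tpow Y a) Q (tpow Y m)).hom := by
      rw [← id_tensorHom, ← tensorHom_id, associator_naturality]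
    have h4 : (β_ Q (tpow X a)).hom ▷ tpow X m ≫ ((tpowMap h a ▷ Q) ⊗ₘ tpowMap h m) =
        ((Q ◁ tpowMap h a) ⊗ₘ tpowMap h m) ≫ (β_ Q (tpow Y a)).hom ▷ tpow Y m := by
      rw [← tensorHom_id _ (tpow X m), ← tensorHom_id _ (tpow Y m), tensorHom_comp_tensorHom,
        tensorHom_comp_tensorHom, BraidedCategory.braiding_naturality_right]
      simp
    have h5 : (α_ Q (tpow X a) (tpow X m)).inv ≫ ((Q ◁ tpowMap h a) ⊗ₘ tpowMap h m) =
        (Q ◁ (tpowMap h a ⊗ₘ tpowMap h m)) ≫ (α_ Q (tpow Y a) (tpow Y m)).inv := by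
      rw [← id_tensorHom, ← id_tensorHom, associator_inv_naturality]
    have h6 : Q ◁ (tpowSplit X a m).hom ≫ Q ◁ (tpowMap h a ⊗ₘ tpowMap h m) =
        Q ◁ tpowMap h (a + m) ≫ Q ◁ (tpowSplit Y a m).hom := by
      rw [← whiskerLeft_comp, ← whiskerLeft_comp, tpowSplit_naturality]
    simp only [plug, h1, Category.assoc]
    rw [h2, reassoc_of% h3, reassoc_of% h4, reassoc_of% h5, reassoc_of% h6]
    rfl
  | b + 1 => by
    have ih := plug_naturality a m f g h w b
    have h1 : tpowMap h (a + m + (b + 1)) = tpowMap h (a + m + b) ⊗ₘ h := rfl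
    have h2 : tpowMap h (a + 1 + (b + 1)) = tpowMap h (a + 1 + b) ⊗ₘ h := rfl
    simp only [plug, h1, h2, Category.assoc]
    have h3 : plug a m f b ▷ X ≫ (tpowMap h (a + 1 + b) ⊗ₘ h) =
        ((Q ◁ tpowMap h (a + m + b)) ⊗ₘ h) ≫ plug a m g b ▷ Y := by
      rw [← tensorHom_id, ← tensorHom_id, tensorHom_comp_tensorHom, tensorHom_comp_tensorHom, ih]
      simp
    have h4 : (α_ Q (tpow X (a + m + b)) X).inv ≫ ((Q ◁ tpowMap h (a + m + b)) ⊗ₘ h) =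
        (Q ◁ (tpowMap h (a + m + b) ⊗ₘ h)) ≫ (α_ Q (tpow Y (a + m + b)) Y).inv := by
      rw [← id_tensorHom, ← id_tensorHom, associator_inv_naturality]
    rw [h3, reassoc_of% h4]

end TensorPowers

/-! ### Symmetric operads and their algebras -/

/-- The identification of `a + m + b` consecutive inputs with `a` inputs, followed by `m` inputs,
followed by `b` inputs. -/
def slotEquiv (a m b : ℕ) : (Fin a ⊕ Fin b) ⊕ Fin m ≃ Fin (a + m + b) :=
  (Equiv.sumAssoc (Fin a) (Fin b) (Fin m)).trans <|
    (Equiv.sumCongr (Equiv.refl (Fin a)) (Equiv.sumComm (Fin b) (Fin m))).trans <|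
    (Equiv.sumAssoc (Fin a) (Fin m) (Fin b)).symm.trans <|
    (Equiv.sumCongr finSumFinEquiv (Equiv.refl (Fin b))).trans finSumFinEquiv

/-- The bijection `Fin (a + m + b) ≃ Fin (a' + m' + b')` which is `τ` from the middle block to the
middle block and `ρ` on the other inputs. -/
def blockEquiv {a b m a' b' m' : ℕ} (ρ : Fin a ⊕ Fin b ≃ Fin a' ⊕ Fin b') (τ : Fin m ≃ Fin m') :
    Fin (a + m + b) ≃ Fin (a' + m' + b') :=
  (slotEquiv a m b).symm.trans ((Equiv.sumCongr ρ τ).trans (slotEquiv a' m' b'))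

/-- A symmetric operad in a symmetric monoidal category, presented by its partial compositions.

* `ops n` is the object of `n`-ary operations.
* `act` is the right action of the symmetric groups. It is written for bijections
  `e : Fin m ≃ Fin n` (these exist only for `m = n`), so that it also contains the
  identifications `ops m = ops n` that come from equalities `m = n` of natural numbers. The
  operation `λ · e` feeds its `j`-th input into the input number `e j` of `λ`.
* `comp a m b` plugs an `m`-ary operation into the input of an `(a + 1 + b)`-ary operation that
  is preceded by `a` inputs and followed by `b` inputs. -/
structure SymmOperad (A : Type u) [Category.{v} A] [MonoidalCategory A] [SymmetricCategory A] where
  ops : ℕ → A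
  act {m n : ℕ} (e : Fin m ≃ Fin n) : ops n ⟶ ops m
  unit : 𝟙_ A ⟶ ops 1
  comp (a m b : ℕ) : ops (a + 1 + b) ⊗ ops m ⟶ ops (a + m + b)
  act_refl (n : ℕ) : act (Equiv.refl (Fin n)) = 𝟙 (ops n)
  act_trans {l m n : ℕ} (e : Fin l ≃ Fin m) (f : Fin m ≃ Fin n) :
    act (e.trans f) = act f ≫ act e
  /-- Equivariance: if `σ` sends the slot number `a` to the slot number `a'`, then
  `(λ · σ) ∘ₐ (μ · τ)` is `(λ ∘ₐ' μ)` acted upon by `σ` with `τ` inserted in the slot. -/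
  comp_act {a b a' b' m m' : ℕ} (ρ : Fin a ⊕ Fin b ≃ Fin a' ⊕ Fin b') (τ : Fin m ≃ Fin m') :
    (act (blockEquiv ρ (Equiv.refl (Fin 1))) ⊗ₘ act τ) ≫ comp a m b =
      comp a' m' b' ≫ act (blockEquiv ρ τ)
  /-- `λ ∘ₐ 1 = λ` -/
  comp_unit (a b : ℕ) : ops (a + 1 + b) ◁ unit ≫ comp a 1 b = (ρ_ (ops (a + 1 + b))).hom
  /-- `1 ∘ μ = μ` -/
  unit_comp (m : ℕ) :
    unit ▷ ops m ≫ (act (finCongr (by lia : 0 + 1 + 0 = 1)) ▷ ops m) ≫ comp 0 m 0 =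
      (λ_ (ops m)).hom ≫ act (finCongr (by lia : 0 + m + 0 = m))
  /-- Sequential composition: `(λ ∘ μ) ∘ ν = λ ∘ (μ ∘ ν)` -/
  comp_assoc (a b c d n : ℕ) :
    comp a (c + 1 + d) b ▷ ops n ≫
        act (finCongr (by lia : a + c + 1 + (d + b) = a + (c + 1 + d) + b)) ▷ ops n ≫
        comp (a + c) n (d + b) =
      (α_ (ops (a + 1 + b)) (ops (c + 1 + d)) (ops n)).hom ≫
        ops (a + 1 + b) ◁ comp c n d ≫ comp a (c + n + d) b ≫
        act (finCongr (by lia : a + c + n + (d + b) = a + (c + n + d) + b))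
  /-- Parallel composition: plugging `μ` and `ν` into two different inputs of `λ` can be done in
  either order. -/
  comp_comm (a b c m n : ℕ) :
    act (finCongr (by lia : a + 1 + (b + 1 + c) = a + 1 + b + 1 + c)) ▷ ops m ▷ ops n ≫
        comp a m (b + 1 + c) ▷ ops n ≫
        act (finCongr (by lia : a + m + b + 1 + c = a + m + (b + 1 + c))) ▷ ops n ≫
        comp (a + m + b) n c =
      (α_ (ops (a + 1 + b + 1 + c)) (ops m) (ops n)).hom ≫
        ops (a + 1 + b + 1 + c) ◁ (β_ (ops m) (ops n)).hom ≫
        (α_ (ops (a + 1 + b + 1 + c)) (ops n) (ops m)).inv ≫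
        comp (a + 1 + b) n c ▷ ops m ≫
        act (finCongr (by lia : a + 1 + (b + n + c) = a + 1 + b + n + c)) ▷ ops m ≫
        comp a m (b + n + c) ≫
        act (finCongr (by lia : a + m + b + n + c = a + m + (b + n + c)))

namespace SymmOperad

variable {A : Type u} [Category.{v} A] [MonoidalCategory A] [SymmetricCategory A]

/-- An operad is reduced if `P₀ = 0` and `P₁` is the unit object `k` (through the operad unit). -/
structure IsReduced (P : SymmOperad A) : Prop where
  isZero_ops_zero : IsZero (P.ops 0)
  isIso_unit : IsIso P.unit

/-- An algebra over the operad `P`: an object `X` with structure maps `Pₙ ⊗ X ^ ⊗ n ⟶ X` that are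
equivariant, unital and compatible with the partial compositions. -/
structure Alg (P : SymmOperad A) where
  X : A
  str (n : ℕ) : P.ops n ⊗ tpow X n ⟶ X
  /-- `(λ · e)(x) = λ (e • x)`, where `e` moves the `j`-th factor of `x` to the place `e j` -/
  str_act {m n : ℕ} (e : Fin m ≃ Fin n) :
    P.act e ▷ tpow X m ≫ str m = P.ops n ◁ tpowPerm X e ≫ str n
  str_unit : P.unit ▷ tpow X 1 ≫ str 1 = (λ_ (tpow X 1)).hom ≫ (λ_ X).hom
  /-- `(λ ∘ₐ μ)(x₁, …, xₐ, y₁, …, yₘ, z₁, …, z_b) = λ (x₁, …, xₐ, μ (y₁, …, yₘ), z₁, …, z_b)` -/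
  str_comp (a m b : ℕ) :
    P.comp a m b ▷ tpow X (a + m + b) ≫ str (a + m + b) =
      (α_ (P.ops (a + 1 + b)) (P.ops m) (tpow X (a + m + b))).hom ≫
        P.ops (a + 1 + b) ◁ plug a m (str m) b ≫ str (a + 1 + b)

namespace Alg

variable {P : SymmOperad A}

/-- Morphisms of algebras over an operad. -/
@[ext]
structure Hom (E F : P.Alg) where
  hom : E.X ⟶ F.X
  comm (n : ℕ) : P.ops n ◁ tpowMap hom n ≫ F.str n = E.str n ≫ hom

instance : Category P.Alg where
  Hom := Hom
  id E := ⟨𝟙 E.X, fun n => by simp [tpowMap_id]⟩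
  comp {E F G} f g := ⟨f.hom ≫ g.hom, fun n => by
    rw [tpowMap_comp, whiskerLeft_comp, Category.assoc, g.comm, ← Category.assoc, f.comm,
      Category.assoc]⟩
  id_comp f := Hom.ext (Category.id_comp f.hom)
  comp_id f := Hom.ext (Category.comp_id f.hom)
  assoc f g h := Hom.ext (Category.assoc f.hom g.hom h.hom)

@[ext]
theorem hom_ext {E F : P.Alg} {f g : E ⟶ F} (h : f.hom = g.hom) : f = g := Hom.ext h

@[simp]
theorem id_hom (E : P.Alg) : Hom.hom (𝟙 E) = 𝟙 E.X := rfl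

@[simp]
theorem comp_hom {E F G : P.Alg} (f : E ⟶ F) (g : F ⟶ G) : (f ≫ g).hom = f.hom ≫ g.hom := rfl

theorem str_act_aux {E : P.Alg} {Q : A} (q : ∀ n, P.ops n ⊗ tpow Q n ⟶ Q) (p : Q ⟶ E.X)
    (hp : ∀ n, P.ops n ◁ tpowMap p n ≫ E.str n = q n ≫ p) {m n : ℕ} (e : Fin m ≃ Fin n) :
    (P.act e ▷ tpow Q m ≫ q m) ≫ p = (P.ops n ◁ tpowPerm Q e ≫ q n) ≫ p := by
  rw [Category.assoc, Category.assoc, ← hp, ← hp, ← whiskerLeft_comp_assoc, ← tpowPerm_naturality,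
    whiskerLeft_comp_assoc, ← E.str_act, whisker_exchange_assoc]

theorem str_unit_aux {E : P.Alg} {Q : A} (q : ∀ n, P.ops n ⊗ tpow Q n ⟶ Q) (p : Q ⟶ E.X)
    (hp : ∀ n, P.ops n ◁ tpowMap p n ≫ E.str n = q n ≫ p) :
    (P.unit ▷ tpow Q 1 ≫ q 1) ≫ p = ((λ_ (tpow Q 1)).hom ≫ (λ_ Q).hom) ≫ p := by
  have h : tpowMap p 1 ≫ (λ_ E.X).hom = (λ_ Q).hom ≫ p := by
    have : tpowMap p 1 = 𝟙_ A ◁ p := id_tensorHom _ _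
    rw [this]
    exact leftUnitor_naturality p
  rw [Category.assoc, ← hp, ← whisker_exchange_assoc, E.str_unit, leftUnitor_naturality_assoc]
  exact (congrArg ((λ_ (tpow Q 1)).hom ≫ ·) h).trans (Category.assoc _ _ _).symm

theorem str_comp_aux {E : P.Alg} {Q : A} (q : ∀ n, P.ops n ⊗ tpow Q n ⟶ Q) (p : Q ⟶ E.X)
    (hp : ∀ n, P.ops n ◁ tpowMap p n ≫ E.str n = q n ≫ p) (a m b : ℕ) :
    (P.comp a m b ▷ tpow Q (a + m + b) ≫ q (a + m + b)) ≫ p =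
      ((α_ (P.ops (a + 1 + b)) (P.ops m) (tpow Q (a + m + b))).hom ≫
        P.ops (a + 1 + b) ◁ plug a m (q m) b ≫ q (a + 1 + b)) ≫ p := by
  simp only [Category.assoc]
  rw [← hp, ← hp, ← whiskerLeft_comp_assoc, ← plug_naturality a m (q m) (E.str m) p (hp m) b,
    ← whisker_exchange_assoc, E.str_comp, whiskerLeft_comp_assoc]
  simp

/-! Pullbacks of algebras exist, and are computed in the underlying category. -/

section Pullbacks

variable [HasPullbacks A] {E F B : P.Alg} (f : E ⟶ B) (g : F ⟶ B)

/-- The structure maps of the pullback algebra. -/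
noncomputable def pullbackStr (n : ℕ) :
    P.ops n ⊗ tpow (pullback f.hom g.hom) n ⟶ pullback f.hom g.hom :=
  pullback.lift (P.ops n ◁ tpowMap (pullback.fst f.hom g.hom) n ≫ E.str n)
    (P.ops n ◁ tpowMap (pullback.snd f.hom g.hom) n ≫ F.str n) (by
      rw [Category.assoc, Category.assoc, ← f.comm, ← g.comm, ← whiskerLeft_comp_assoc,
        ← whiskerLeft_comp_assoc, ← tpowMap_comp, ← tpowMap_comp, pullback.condition])

theorem pullbackStr_fst (n : ℕ) :
    P.ops n ◁ tpowMap (pullback.fst f.hom g.hom) n ≫ E.str n =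
      pullbackStr f g n ≫ pullback.fst f.hom g.hom :=
  (pullback.lift_fst _ _ _).symm

theorem pullbackStr_snd (n : ℕ) :
    P.ops n ◁ tpowMap (pullback.snd f.hom g.hom) n ≫ F.str n =
      pullbackStr f g n ≫ pullback.snd f.hom g.hom :=
  (pullback.lift_snd _ _ _).symm

/-- The pullback algebra. -/
@[reducible]
noncomputable def pullbackAlg : P.Alg where
  X := pullback f.hom g.hom
  str := pullbackStr f g
  str_act e := pullback.hom_ext (str_act_aux _ _ (pullbackStr_fst f g) e)
    (str_act_aux _ _ (pullbackStr_snd f g) e)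
  str_unit := pullback.hom_ext (str_unit_aux _ _ (pullbackStr_fst f g))
    (str_unit_aux _ _ (pullbackStr_snd f g))
  str_comp a m b := pullback.hom_ext (str_comp_aux _ _ (pullbackStr_fst f g) a m b)
    (str_comp_aux _ _ (pullbackStr_snd f g) a m b)

/-- The projections of the pullback algebra. -/
noncomputable def pullbackAlgFst : pullbackAlg f g ⟶ E :=
  Hom.mk (pullback.fst f.hom g.hom) (pullbackStr_fst f g)

noncomputable def pullbackAlgSnd : pullbackAlg f g ⟶ F :=
  Hom.mk (pullback.snd f.hom g.hom) (pullbackStr_snd f g)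

/-- The map into the pullback algebra induced by a commutative square. -/
noncomputable def pullbackAlgLift {T : P.Alg} (x : T ⟶ E) (y : T ⟶ F) (w : x ≫ f = y ≫ g) :
    T ⟶ pullbackAlg f g :=
  Hom.mk (pullback.lift x.hom y.hom (congrArg Hom.hom w)) (fun n => by
    apply pullback.hom_ext
    · have h := pullbackStr_fst f g n
      have : (pullbackAlg f g).str n = pullbackStr f g n := rfl
      rw [this, Category.assoc, ← h, ← whiskerLeft_comp_assoc, ← tpowMap_comp, Category.assoc,
        pullback.lift_fst, x.comm]
    · have h := pullbackStr_snd f g n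
      have : (pullbackAlg f g).str n = pullbackStr f g n := rfl
      rw [this, Category.assoc, ← h, ← whiskerLeft_comp_assoc, ← tpowMap_comp, Category.assoc,
        pullback.lift_snd, y.comm])

theorem pullbackAlg_condition : pullbackAlgFst f g ≫ f = pullbackAlgSnd f g ≫ g :=
  hom_ext pullback.condition

/-- The pullback algebra is a pullback in the category of algebras. -/
noncomputable def pullbackAlgIsLimit :
    IsLimit (PullbackCone.mk _ _ (pullbackAlg_condition f g)) :=
  PullbackCone.IsLimit.mk _ (fun c => pullbackAlgLift f g c.fst c.snd c.condition)
    (fun _ => hom_ext (pullback.lift_fst _ _ _)) (fun _ => hom_ext (pullback.lift_snd _ _ _))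
    (fun _ _ h₁ h₂ => hom_ext (pullback.hom_ext
      ((congrArg Hom.hom h₁).trans (pullback.lift_fst _ _ _).symm)
      ((congrArg Hom.hom h₂).trans (pullback.lift_snd _ _ _).symm)))

instance : HasPullbacks P.Alg :=
  have (E F B : P.Alg) (f : E ⟶ B) (g : F ⟶ B) : HasLimit (cospan f g) :=
    ⟨⟨⟨_, pullbackAlgIsLimit f g⟩⟩⟩
  hasPullbacks_of_hasLimit_cospan _

end Pullbacks

end Alg

end SymmOperad

/-! ### Reflexive graphs and internal categories -/

/-- A reflexive graph in `C`: a diagram `s, t : E ⇉ B`, `i : B ⟶ E` with `s i = t i = 𝟙`. -/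
structure ReflexiveGraph (C : Type u) [Category.{v} C] where
  E : C
  B : C
  s : E ⟶ B
  t : E ⟶ B
  i : B ⟶ E
  i_s : i ≫ s = 𝟙 B
  i_t : i ≫ t = 𝟙 B

namespace ReflexiveGraph

variable {C : Type u} [Category.{v} C]

/-- Morphisms of reflexive graphs: morphisms of diagrams. -/
@[ext]
structure Hom (G H : ReflexiveGraph C) where
  onE : G.E ⟶ H.E
  onB : G.B ⟶ H.B
  comm_s : G.s ≫ onB = onE ≫ H.s
  comm_t : G.t ≫ onB = onE ≫ H.t
  comm_i : G.i ≫ onE = onB ≫ H.i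

instance : Category (ReflexiveGraph C) where
  Hom := Hom
  id G := ⟨𝟙 G.E, 𝟙 G.B, by simp, by simp, by simp⟩
  comp f g := ⟨f.onE ≫ g.onE, f.onB ≫ g.onB,
    by rw [← Category.assoc, f.comm_s, Category.assoc, g.comm_s, Category.assoc],
    by rw [← Category.assoc, f.comm_t, Category.assoc, g.comm_t, Category.assoc],
    by rw [← Category.assoc, f.comm_i, Category.assoc, g.comm_i, Category.assoc]⟩
  id_comp f := Hom.ext (Category.id_comp f.onE) (Category.id_comp f.onB)
  comp_id f := Hom.ext (Category.comp_id f.onE) (Category.comp_id f.onB)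
  assoc f g h := Hom.ext (Category.assoc f.onE g.onE h.onE) (Category.assoc f.onB g.onB h.onB)

@[simp]
theorem id_onE (G : ReflexiveGraph C) : Hom.onE (𝟙 G) = 𝟙 G.E := rfl

@[simp]
theorem id_onB (G : ReflexiveGraph C) : Hom.onB (𝟙 G) = 𝟙 G.B := rfl

@[simp]
theorem comp_onE {G H K : ReflexiveGraph C} (f : G ⟶ H) (g : H ⟶ K) :
    (f ≫ g).onE = f.onE ≫ g.onE := rfl

@[simp]
theorem comp_onB {G H K : ReflexiveGraph C} (f : G ⟶ H) (g : H ⟶ K) :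
    (f ≫ g).onB = f.onB ≫ g.onB := rfl

end ReflexiveGraph

/-- An internal category structure on a reflexive graph: a composition
`E ×_B E ⟶ E`, `(g, f) ↦ g ∘ f`, defined on the pairs with `s g = t f`, such that
`s (g ∘ f) = s f`, `t (g ∘ f) = t g`, `g ∘ i (s g) = g`, `i (t f) ∘ f = f`, and
`(h ∘ g) ∘ f = h ∘ (g ∘ f)` for all (generalized) elements. -/
@[ext]
structure InternalCategoryStructure {C : Type u} [Category.{v} C] [HasPullbacks C]
    (G : ReflexiveGraph C) where
  comp : pullback G.s G.t ⟶ G.E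
  comp_s : comp ≫ G.s = pullback.snd G.s G.t ≫ G.s
  comp_t : comp ≫ G.t = pullback.fst G.s G.t ≫ G.t
  comp_id : pullback.lift (𝟙 G.E) (G.s ≫ G.i)
    (by rw [Category.assoc, G.i_t, Category.comp_id, Category.id_comp]) ≫ comp = 𝟙 G.E
  id_comp : pullback.lift (G.t ≫ G.i) (𝟙 G.E)
    (by rw [Category.assoc, G.i_s, Category.comp_id, Category.id_comp]) ≫ comp = 𝟙 G.E
  assoc {T : C} (h g f : T ⟶ G.E) (w₁ : h ≫ G.s = g ≫ G.t) (w₂ : g ≫ G.s = f ≫ G.t) :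
    pullback.lift (pullback.lift h g w₁ ≫ comp) f
        (by rw [Category.assoc, comp_s, pullback.lift_snd_assoc, w₂]) ≫ comp =
      pullback.lift h (pullback.lift g f w₂ ≫ comp)
        (by rw [Category.assoc, comp_t, pullback.lift_fst_assoc, w₁]) ≫ comp

/-- A category internal to `C`. -/
structure InternalCategory (C : Type u) [Category.{v} C] [HasPullbacks C] where
  graph : ReflexiveGraph C
  str : InternalCategoryStructure graph

namespace InternalCategory

variable {C : Type u} [Category.{v} C] [HasPullbacks C]

/-- An internal functor: a morphism of reflexive graphs that commutes with the compositions. -/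
@[ext]
structure Hom (X Y : InternalCategory C) where
  toGraphHom : X.graph ⟶ Y.graph
  map_comp : X.str.comp ≫ toGraphHom.onE =
    pullback.map X.graph.s X.graph.t Y.graph.s Y.graph.t toGraphHom.onE toGraphHom.onE
      toGraphHom.onB toGraphHom.comm_s toGraphHom.comm_t ≫ Y.str.comp

instance : Category (InternalCategory C) where
  Hom := Hom
  id X := ⟨𝟙 X.graph, by simp⟩
  comp {X Y Z} f g := ⟨f.toGraphHom ≫ g.toGraphHom, by
    simp only [ReflexiveGraph.comp_onE, ReflexiveGraph.comp_onB]
    rw [← Category.assoc, f.map_comp, Category.assoc, g.map_comp, ← Category.assoc,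
      pullback.map_comp]⟩
  id_comp f := Hom.ext (Category.id_comp f.toGraphHom)
  comp_id f := Hom.ext (Category.comp_id f.toGraphHom)
  assoc f g h := Hom.ext (Category.assoc f.toGraphHom g.toGraphHom h.toGraphHom)

variable (C) in
/-- The functor that forgets the composition of an internal category. -/
@[simps]
def forget : InternalCategory C ⥤ ReflexiveGraph C where
  obj X := X.graph
  map f := f.toGraphHom

end InternalCategory

/-! ### The `Cat¹`-condition -/

namespace SymmOperad

variable {A : Type u} [Category.{v} A] [Abelian A] [MonoidalCategory A] [SymmetricCategory A]

/-- The restriction of the `(m + 2)`-ary structure map of `E` to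
`ker s ⊗ ker t ⊗ E ^ ⊗ m`. -/
noncomputable def peifferMap {P : SymmOperad A} (G : ReflexiveGraph P.Alg) (m : ℕ) :
    P.ops (2 + m) ⊗ ((kernel G.s.hom ⊗ kernel G.t.hom) ⊗ tpow G.E.X m) ⟶ G.E.X :=
  P.ops (2 + m) ◁
      (((kernel.ι G.s.hom ⊗ₘ kernel.ι G.t.hom) ≫ (λ_ G.E.X).inv ▷ G.E.X) ▷ tpow G.E.X m ≫
        (tpowSplit G.E.X 2 m).inv) ≫
    G.E.str (2 + m)

/-- The `Cat¹`-condition: for all `n = 2 + m ≥ 2` the `n`-ary operations vanish on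
`ker s ⊗ ker t ⊗ E ^ ⊗ (n - 2)`. -/
def IsCatOne (P : SymmOperad A) : ObjectProperty (ReflexiveGraph P.Alg) :=
  fun G => ∀ m : ℕ, peifferMap G m = 0

/-- The full subcategory of reflexive graphs of `P`-algebras on the `Cat¹`-`P`-algebras. -/
abbrev CatOne (P : SymmOperad A) := P.IsCatOne.FullSubcategory

end SymmOperad

/-!
A composition on a reflexive graph `s, t : E ⇉ B`, `i : B ⟶ E` of `P`-algebras is in particular a
morphism of the abelian category `A`, and `(g, f) = (g, i (s g)) + (i (t f), f) -
(i (s g), i (s g))` for a composable pair. The unit laws thus force `g ∘ f = g + f - i (s g)`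
(`SymmOperad.comp_hom_eq`). This gives uniqueness, and shows that every morphism of reflexive
graphs commutes with the compositions. The formula always satisfies the axioms of a category in
`A`; what is left is to decide when it defines a morphism of algebras.

If it does, then for `x ∈ ker s` and `y ∈ ker t` one has `x = x ∘ 0`, `y = 0 ∘ y` and
`z = z ∘ i (s z)`, hence `λ (x, y, z, …) = λ (x, 0, z, …) ∘ λ (0, y, i (s z), …) = 0 ∘ 0 = 0`
(`SymmOperad.isCatOne_of_internalCategoryStructure`).

Conversely, write `e = i (s g)`, `g = e + x` and `f = e + y`, so that `x ∈ ker s`, `y ∈ ker t` and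
`g ∘ f = e + x + y`. The tensor power `(e + x + y) ^ ⊗ n` equals
`(e + x) ^ ⊗ n + (e + y) ^ ⊗ n - e ^ ⊗ n` up to tensor products that contain both an `x` and a `y`
(`tpowMap_sub_mem_tensorsContainingBoth`). By equivariance, the `Cat¹`-condition says that
operations vanish on the latter wherever `x` and `y` stand
(`SymmOperad.IsCatOne.str_eq_zero_of_mem`), whence
`λ (g ∘ f, …) = λ (g, …) + λ (f, …) - λ (e, …) = λ (g, …) ∘ λ (f, …)`
(`SymmOperad.IsCatOne.add_sub_comm_str`). Closedness of the monoidal structure enters only through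
the additivity of the tensor product. The argument is uniform in the arity: in arities `0` and `1`
the expansion has no mixed terms, and the two sides agree.
-/

/-! ### Tensor products of families of morphisms -/

section TensorFamilies

variable {A : Type u} [Category.{v} A] [MonoidalCategory A]

/-- The tensor product `(((𝟙 ⊗ f₀) ⊗ f₁) ⊗ ⋯) ⊗ fₙ₋₁` of a family of morphisms `X ⟶ Y`. -/
def tpowFamily {X Y : A} : ∀ {n : ℕ} (_ : Fin n → (X ⟶ Y)), tpow X n ⟶ tpow Y n
  | 0, _ => 𝟙 (𝟙_ A)
  | n + 1, f => tpowFamily (fun j : Fin n => f j.castSucc) ⊗ₘ f (Fin.last n)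

theorem tpowFamily_succ {X Y : A} {n : ℕ} (f : Fin (n + 1) → (X ⟶ Y)) :
    tpowFamily f = tpowFamily (fun j : Fin n => f j.castSucc) ⊗ₘ f (Fin.last n) :=
  rfl

theorem tpowMap_succ {X Y : A} (f : X ⟶ Y) (n : ℕ) : tpowMap f (n + 1) = tpowMap f n ⊗ₘ f :=
  rfl

theorem tpowFamily_const {X Y : A} (f : X ⟶ Y) : ∀ n : ℕ,
    tpowFamily (fun _ : Fin n => f) = tpowMap f n
  | 0 => rfl
  | n + 1 => by rw [tpowFamily_succ, tpowFamily_const f n, tpowMap_succ]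

theorem tpowFamily_snoc {X Y : A} {n : ℕ} (f : Fin n → (X ⟶ Y)) (h : X ⟶ Y) :
    tpowFamily (Fin.snoc (α := fun _ => X ⟶ Y) f h) = tpowFamily f ⊗ₘ h := by
  rw [tpowFamily_succ]
  simp

theorem tpowFamily_split {X Y : A} (a : ℕ) : ∀ {m : ℕ} (f : Fin (a + m) → (X ⟶ Y)),
    tpowFamily f ≫ (tpowSplit Y a m).hom = (tpowSplit X a m).hom ≫
      (tpowFamily (fun j : Fin a => f (j.castAdd m)) ⊗ₘ
        tpowFamily (fun j : Fin m => f (j.natAdd a)))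
  | 0, f => by
    have h : tpowFamily (fun j : Fin 0 => f (j.natAdd a)) = 𝟙 (𝟙_ A) := rfl
    rw [h, tensorHom_id]
    exact rightUnitor_inv_naturality _
  | m + 1, f => by
    have ih := tpowFamily_split a (fun j : Fin (a + m) => f j.castSucc)
    have h1 : tpowFamily f =
      tpowFamily (fun j : Fin (a + m) => f j.castSucc) ⊗ₘ f (Fin.last (a + m)) := rfl
    have h2 : tpowFamily (fun j : Fin (m + 1) => f (j.natAdd a)) =
      tpowFamily (fun j : Fin m => f (j.castSucc.natAdd a)) ⊗ₘ f (Fin.last (a + m)) := rfl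
    have key : tpowFamily f ≫ (tpowSplit Y a m).hom ▷ Y = (tpowSplit X a m).hom ▷ X ≫
        ((tpowFamily (fun j : Fin a => f (j.castAdd (m + 1))) ⊗ₘ
          tpowFamily (fun j : Fin m => f (j.castSucc.natAdd a))) ⊗ₘ f (Fin.last (a + m))) := by
      rw [h1, ← tensorHom_id, ← tensorHom_id, tensorHom_comp_tensorHom, tensorHom_comp_tensorHom,
        ih, Category.comp_id, Category.id_comp]
      rfl
    simp only [tpowSplit, h2, Iso.trans_hom, whiskerRightIso_hom]
    calc _ = (tpowFamily f ≫ (tpowSplit Y a m).hom ▷ Y) ≫ (α_ _ _ _).hom :=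
          (Category.assoc _ _ _).symm
      _ = _ := by
          rw [key, Category.assoc, associator_naturality]
          exact (Category.assoc _ _ _).symm

variable [SymmetricCategory A]

theorem tpowFamily_insert {X Y : A} : ∀ (n : ℕ) (k : Fin (n + 1)) (f : Fin (n + 1) → (X ⟶ Y)),
    (tpowFamily (fun j => f (k.succAbove j)) ⊗ₘ f k) ≫ tpowInsert Y n k =
      tpowInsert X n k ≫ tpowFamily f
  | 0, k, f => by
    obtain rfl : k = Fin.last 0 := Subsingleton.elim (α := Fin 1) _ _
    exact (Category.comp_id _).trans (Category.id_comp _).symm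
  | n + 1, k, f => by
    induction k using Fin.lastCases with
    | last =>
      simp only [tpowInsert, Fin.lastCases_last, Fin.succAbove_last]
      exact (Category.comp_id _).trans (Category.id_comp _).symm
    | cast k' =>
      simp only [tpowInsert, Fin.lastCases_castSucc, Category.assoc]
      have ih := tpowFamily_insert n k' (fun j => f j.castSucc)
      have h1 : tpowFamily (fun j => f (k'.castSucc.succAbove j)) =
          tpowFamily (fun j => f (k'.succAbove j).castSucc) ⊗ₘ f (Fin.last (n + 1)) := by
        rw [tpowFamily_succ]
        simp
      have h3 : tpowInsert X n k' ▷ X ≫ tpowFamily f =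
          ((tpowFamily (fun j => f (k'.succAbove j).castSucc) ⊗ₘ f k'.castSucc) ⊗ₘ
            f (Fin.last (n + 1))) ≫ tpowInsert Y n k' ▷ Y := by
        rw [tpowFamily_succ, ← tensorHom_id, ← tensorHom_id, tensorHom_comp_tensorHom,
          tensorHom_comp_tensorHom, ih, Category.comp_id, Category.id_comp]
      refine Eq.trans ?_ (congrArg (fun z => (α_ (tpow X n) X X).hom ≫ tpow X n ◁ (β_ X X).hom ≫
        (α_ (tpow X n) X X).inv ≫ z) h3.symm)
      rw [h1]
      generalize f k'.castSucc = p
      generalize f (Fin.last (n + 1)) = q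
      generalize tpowFamily (fun j => f (k'.succAbove j).castSucc) = r
      have h4 : (r ⊗ₘ (q ⊗ₘ p)) ≫ tpow Y n ◁ (β_ Y Y).hom =
          tpow X n ◁ (β_ X X).hom ≫ (r ⊗ₘ (p ⊗ₘ q)) := by
        rw [← id_tensorHom, ← id_tensorHom, tensorHom_comp_tensorHom, tensorHom_comp_tensorHom,
          BraidedCategory.braiding_naturality]
        simp
      have h5 := associator_naturality r q p
      have h6 := associator_inv_naturality r p q
      rw [← reassoc_of% h6, ← reassoc_of% h4, ← reassoc_of% h5]

theorem succAbove_restrictEquiv {m n : ℕ} (e : Fin (m + 1) ≃ Fin (n + 1)) (j : Fin m) :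
    (e (Fin.last m)).succAbove (restrictEquiv e j) = e j.castSucc := by
  have hne : e j.castSucc ≠ e (Fin.last m) := e.injective.ne (Fin.castSucc_lt_last j).ne
  obtain ⟨i, hi⟩ := Fin.exists_succAbove_eq hne
  have h : (finSuccEquivLast.symm.trans (e.trans (finSuccEquiv' (e (Fin.last m))))) (some j) =
      some i := by
    simp [← hi]
  have h' := Equiv.removeNone_some _ ⟨i, h⟩
  rw [h, Option.some_inj] at h'
  rw [restrictEquiv, h', hi]

/-- The action of a bijection on tensor powers permutes the factors of a tensor product of
morphisms. -/
theorem tpowFamily_perm {X Y : A} : ∀ {m n : ℕ} (e : Fin m ≃ Fin n) (f : Fin n → (X ⟶ Y)),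
    tpowFamily (fun j => f (e j)) ≫ tpowPerm Y e = tpowPerm X e ≫ tpowFamily f
  | 0, 0, _, _ => (Category.comp_id _).trans (Category.id_comp _).symm
  | 0, _ + 1, e, _ => (e.symm 0).elim0
  | _ + 1, 0, e, _ => (e 0).elim0
  | m + 1, n + 1, e, f => by
    have ih := tpowFamily_perm (restrictEquiv e) (fun j => f ((e (Fin.last m)).succAbove j))
    simp only [succAbove_restrictEquiv] at ih
    have h := tpowFamily_insert n (e (Fin.last m)) f
    simp only [tpowPerm, tpowFamily_succ (fun j => f (e j)), Category.assoc]
    rw [← h]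
    have h3 : tpowPerm X (restrictEquiv e) ▷ X ≫
        (tpowFamily (fun j => f ((e (Fin.last m)).succAbove j)) ⊗ₘ f (e (Fin.last m))) =
        (tpowFamily (fun j : Fin m => f (e j.castSucc)) ⊗ₘ f (e (Fin.last m))) ≫
          tpowPerm Y (restrictEquiv e) ▷ Y := by
      rw [← tensorHom_id, ← tensorHom_id, tensorHom_comp_tensorHom, tensorHom_comp_tensorHom, ih,
        Category.comp_id, Category.id_comp]
    exact (Category.assoc _ _ _).symm.trans
      ((congrArg (· ≫ tpowInsert Y n (e (Fin.last m))) h3.symm).trans (Category.assoc _ _ _))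

end TensorFamilies

/-! ### Expansion of a tensor power of a sum -/

section Preadditive

variable {A : Type u} [Category.{v} A] [MonoidalCategory A]

/-- The functors `Z ⊗ -` are left adjoints, hence additive; the symmetry carries this over to the
other factor. -/
theorem monoidalPreadditive_of_monoidalClosed [Abelian A] [SymmetricCategory A]
    [MonoidalClosed A] : MonoidalPreadditive A := by
  have additive (Z : A) : (tensorLeft Z).Additive := by
    have : PreservesColimits (tensorLeft Z) := (ihom.adjunction Z).leftAdjoint_preservesColimits
    have : PreservesBinaryBiproducts (tensorLeft Z) :=
      preservesBinaryBiproducts_of_preservesBinaryCoproducts _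
    exact Functor.additive_of_preservesBinaryBiproducts _
  have whiskerLeft_zero (X Y Z : A) : X ◁ (0 : Y ⟶ Z) = 0 := (tensorLeft X).map_zero Y Z
  have whiskerLeft_add (X Y Z : A) (f g : Y ⟶ Z) : X ◁ (f + g) = X ◁ f + X ◁ g :=
    (tensorLeft X).map_add
  have whiskerRight_eq {X Y Z : A} (f : Y ⟶ Z) : f ▷ X = (β_ Y X).hom ≫ X ◁ f ≫ (β_ Z X).inv := by
    rw [← BraidedCategory.braiding_naturality_left_assoc, Iso.hom_inv_id, Category.comp_id]
  exact
    { whiskerLeft_zero := fun {X Y Z} => whiskerLeft_zero X Y Z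
      zero_whiskerRight := fun {X Y Z} => by rw [whiskerRight_eq, whiskerLeft_zero]; simp
      whiskerLeft_add := fun {X Y Z} f g => whiskerLeft_add X Y Z f g
      add_whiskerRight := fun {X Y Z} f g => by
        rw [whiskerRight_eq, whiskerRight_eq, whiskerRight_eq, whiskerLeft_add]; simp }

variable [Preadditive A] [MonoidalPreadditive A]

/-- Tensoring with a fixed morphism on the right, as a homomorphism of groups of morphisms. -/
def tensorHomRight (W Z : A) {X Y : A} (h : X ⟶ Y) : (W ⟶ Z) →+ (W ⊗ X ⟶ Z ⊗ Y) :=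
  AddMonoidHom.mk' (fun w => w ⊗ₘ h) fun w w' => MonoidalPreadditive.add_tensor w w' h

theorem sub_tensorHom {W Z X Y : A} (w w' : W ⟶ Z) (h : X ⟶ Y) :
    (w - w') ⊗ₘ h = (w ⊗ₘ h) - (w' ⊗ₘ h) :=
  (tensorHomRight W Z h).map_sub w w'

/-- The group generated by the tensor products of `n` morphisms one of which is `y`. -/
def tensorsContaining {X Y : A} (y : X ⟶ Y) (n : ℕ) : AddSubgroup (tpow X n ⟶ tpow Y n) :=
  AddSubgroup.closure {w | ∃ (f : Fin n → (X ⟶ Y)) (k : Fin n), f k = y ∧ tpowFamily f = w}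

/-- The group generated by the tensor products of `n` morphisms that contain `x` and `y` at two
different places. -/
def tensorsContainingBoth {X Y : A} (x y : X ⟶ Y) (n : ℕ) : AddSubgroup (tpow X n ⟶ tpow Y n) :=
  AddSubgroup.closure {w | ∃ (f : Fin n → (X ⟶ Y)) (j k : Fin n),
    j ≠ k ∧ f j = x ∧ f k = y ∧ tpowFamily f = w}

theorem tensorHom_mem_tensorsContaining {X Y : A} {y : X ⟶ Y} {n : ℕ} {w : tpow X n ⟶ tpow Y n}
    (hw : w ∈ tensorsContaining y n) (h : X ⟶ Y) : w ⊗ₘ h ∈ tensorsContaining y (n + 1) := by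
  refine (AddSubgroup.closure_le
    ((tensorsContaining y (n + 1)).comap (tensorHomRight _ _ h))).2 ?_ hw
  rintro _ ⟨f, k, hk, rfl⟩
  exact AddSubgroup.subset_closure ⟨Fin.snoc (α := fun _ => X ⟶ Y) f h, k.castSucc, by simpa,
    tpowFamily_snoc f h⟩

theorem tensorHom_mem_tensorsContainingBoth {X Y : A} {x y : X ⟶ Y} {n : ℕ}
    {w : tpow X n ⟶ tpow Y n} (hw : w ∈ tensorsContainingBoth x y n) (h : X ⟶ Y) :
    w ⊗ₘ h ∈ tensorsContainingBoth x y (n + 1) := by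
  refine (AddSubgroup.closure_le
    ((tensorsContainingBoth x y (n + 1)).comap (tensorHomRight _ _ h))).2 ?_ hw
  rintro _ ⟨f, j, k, hjk, hj, hk, rfl⟩
  exact AddSubgroup.subset_closure ⟨Fin.snoc (α := fun _ => X ⟶ Y) f h, j.castSucc, k.castSucc,
    by simpa, by simpa, by simpa, tpowFamily_snoc f h⟩

theorem tensorHom_left_mem_tensorsContainingBoth {X Y : A} {x y : X ⟶ Y} {n : ℕ}
    {w : tpow X n ⟶ tpow Y n} (hw : w ∈ tensorsContaining x n) :
    w ⊗ₘ y ∈ tensorsContainingBoth x y (n + 1) := by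
  refine (AddSubgroup.closure_le
    ((tensorsContainingBoth x y (n + 1)).comap (tensorHomRight _ _ y))).2 ?_ hw
  rintro _ ⟨f, j, hj, rfl⟩
  exact AddSubgroup.subset_closure ⟨Fin.snoc (α := fun _ => X ⟶ Y) f y, j.castSucc, Fin.last n,
    (Fin.castSucc_lt_last j).ne, by simpa, by simp, tpowFamily_snoc f y⟩

theorem tensorHom_right_mem_tensorsContainingBoth {X Y : A} {x y : X ⟶ Y} {n : ℕ}
    {w : tpow X n ⟶ tpow Y n} (hw : w ∈ tensorsContaining y n) :
    w ⊗ₘ x ∈ tensorsContainingBoth x y (n + 1) := by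
  refine (AddSubgroup.closure_le
    ((tensorsContainingBoth x y (n + 1)).comap (tensorHomRight _ _ x))).2 ?_ hw
  rintro _ ⟨f, k, hk, rfl⟩
  exact AddSubgroup.subset_closure ⟨Fin.snoc (α := fun _ => X ⟶ Y) f x, Fin.last n, k.castSucc,
    (Fin.castSucc_lt_last k).ne', by simp, by simpa, tpowFamily_snoc f x⟩

theorem tpowMap_add_sub_mem_tensorsContaining {X Y : A} (c y : X ⟶ Y) : ∀ n : ℕ,
    tpowMap (c + y) n - tpowMap c n ∈ tensorsContaining y n
  | 0 => by
    rw [tpowMap, tpowMap, sub_self]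
    exact zero_mem _
  | n + 1 => by
    have h : tpowMap (c + y) (n + 1) - tpowMap c (n + 1) =
        ((tpowMap (c + y) n - tpowMap c n) ⊗ₘ (c + y)) + (tpowMap c n ⊗ₘ y) := by
      rw [tpowMap_succ, tpowMap_succ, sub_tensorHom]
      simp only [MonoidalPreadditive.tensor_add]
      abel
    rw [h]
    refine add_mem (tensorHom_mem_tensorsContaining
      (tpowMap_add_sub_mem_tensorsContaining c y n) _) (AddSubgroup.subset_closure ?_)
    exact ⟨Fin.snoc (α := fun _ => X ⟶ Y) (fun _ => c) y, Fin.last n, by simp,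
      by rw [tpowFamily_snoc, tpowFamily_const]⟩

/-- Modulo tensor products that contain both `x` and `y`, the tensor power is additive for the
decomposition of `e + x + y` into `e + x` and `e + y`, which have `e` in common. -/
theorem tpowMap_sub_mem_tensorsContainingBoth {X Y : A} (e x y : X ⟶ Y) : ∀ n : ℕ,
    tpowMap (e + x + y) n - tpowMap (e + x) n - tpowMap (e + y) n + tpowMap e n ∈
      tensorsContainingBoth x y n
  | 0 => by
    simp only [tpowMap, sub_self, zero_sub, neg_add_cancel]
    exact zero_mem _
  | n + 1 => by
    have hx := tpowMap_add_sub_mem_tensorsContaining (e + y) x n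
    rw [add_right_comm e y x] at hx
    have hy := tpowMap_add_sub_mem_tensorsContaining (e + x) y n
    have ih := tpowMap_sub_mem_tensorsContainingBoth e x y n
    have h : tpowMap (e + x + y) (n + 1) - tpowMap (e + x) (n + 1) - tpowMap (e + y) (n + 1) +
          tpowMap e (n + 1) =
        ((tpowMap (e + x + y) n - tpowMap (e + x) n - tpowMap (e + y) n + tpowMap e n) ⊗ₘ e) +
          ((tpowMap (e + x + y) n - tpowMap (e + x) n) ⊗ₘ x) +
          ((tpowMap (e + x + y) n - tpowMap (e + y) n) ⊗ₘ y) := by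
      simp only [tpowMap_succ, sub_tensorHom, MonoidalPreadditive.tensor_add,
        MonoidalPreadditive.add_tensor]
      abel
    rw [h]
    exact add_mem (add_mem (tensorHom_mem_tensorsContainingBoth ih e)
      (tensorHom_right_mem_tensorsContainingBoth hy))
      (tensorHom_left_mem_tensorsContainingBoth hx)

end Preadditive

/-! ### The `Cat¹`-condition makes the composition a morphism of algebras -/

section TwoFactors

variable {A : Type u} [Category.{v} A] [MonoidalCategory A]

/-- The morphism `(K ⊗ L) ⊗ W ^ ⊗ m ⟶ X ^ ⊗ (2 + m)` which is `u` on `K`, `v` on `L`, and `r` on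
every factor `W`. -/
def tensorPair {K L W X : A} (u : K ⟶ X) (v : L ⟶ X) (r : W ⟶ X) (m : ℕ) :
    (K ⊗ L) ⊗ tpow W m ⟶ tpow X (2 + m) :=
  (((u ⊗ₘ v) ≫ (λ_ X).inv ▷ X) ⊗ₘ tpowMap r m) ≫ (tpowSplit X 2 m).inv

theorem tensorPair_comp {K L W X Y : A} (u : K ⟶ X) (v : L ⟶ X) (r : W ⟶ X) (h : X ⟶ Y) (m : ℕ) :
    tensorPair u v r m ≫ tpowMap h (2 + m) = tensorPair (u ≫ h) (v ≫ h) (r ≫ h) m := by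
  have h1 : (tpowSplit X 2 m).inv ≫ tpowMap h (2 + m) =
      (tpowMap h 2 ⊗ₘ tpowMap h m) ≫ (tpowSplit Y 2 m).inv := by
    rw [Iso.inv_comp_eq, ← Category.assoc, Iso.eq_comp_inv, tpowSplit_naturality]
  have h2 : ((u ⊗ₘ v) ≫ (λ_ X).inv ▷ X) ≫ tpowMap h 2 =
      ((u ≫ h) ⊗ₘ (v ≫ h)) ≫ (λ_ Y).inv ▷ Y := by
    have h3 : tpowMap h 2 = (𝟙 (𝟙_ A) ⊗ₘ h) ⊗ₘ h := rfl
    have h4 : (λ_ X).inv ▷ X ≫ ((𝟙 (𝟙_ A) ⊗ₘ h) ⊗ₘ h) = (h ⊗ₘ h) ≫ (λ_ Y).inv ▷ Y := by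
      rw [← tensorHom_id, ← tensorHom_id, tensorHom_comp_tensorHom, tensorHom_comp_tensorHom,
        id_tensorHom, ← leftUnitor_inv_naturality, Category.comp_id, Category.id_comp]
    rw [h3, Category.assoc]
    exact (congrArg ((u ⊗ₘ v) ≫ ·) h4).trans (by simp)
  rw [tensorPair, tensorPair, Category.assoc, h1, tensorHom_comp_tensorHom_assoc, ← tpowMap_comp]
  exact congrArg (fun z => (z ⊗ₘ tpowMap (r ≫ h) m) ≫ (tpowSplit Y 2 m).inv) h2

theorem tpowFamily_eq_comp_tensorPair {K L X Y : A} (ι : K ⟶ Y) (κ : L ⟶ Y) {m : ℕ}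
    (f : Fin (2 + m) → (X ⟶ Y)) (p : X ⟶ K) (q : X ⟶ L)
    (h0 : f (Fin.castAdd m 0) = p ≫ ι) (h1 : f (Fin.castAdd m 1) = q ≫ κ) :
    tpowFamily f = (tpowSplit X 2 m).hom ≫
      (((λ_ X).hom ▷ X ≫ (p ⊗ₘ q)) ⊗ₘ tpowFamily (fun j : Fin m => f (j.natAdd 2))) ≫
        tensorPair ι κ (𝟙 Y) m := by
  have h2 : tpowFamily (fun j : Fin 2 => f (j.castAdd m)) =
      ((λ_ X).hom ▷ X ≫ (p ⊗ₘ q)) ≫ (ι ⊗ₘ κ) ≫ (λ_ Y).inv ▷ Y := by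
    have h3 : tpowFamily (fun j : Fin 2 => f (j.castAdd m)) =
        (𝟙 (𝟙_ A) ⊗ₘ f (Fin.castAdd m 0)) ⊗ₘ f (Fin.castAdd m 1) := rfl
    rw [h3, h0, h1, Category.assoc, tensorHom_comp_tensorHom_assoc, ← tensorHom_id, ← tensorHom_id,
      tensorHom_comp_tensorHom, tensorHom_comp_tensorHom, id_tensorHom,
      leftUnitor_inv_naturality, Iso.hom_inv_id_assoc, Category.comp_id, Category.id_comp]
  rw [← cancel_mono (tpowSplit Y 2 m).hom, tpowFamily_split, h2, tensorPair, tpowMap_id]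
  simp only [Category.assoc, Iso.inv_hom_id, Category.comp_id, tensorHom_comp_tensorHom]

theorem exists_equiv_apply_eq {α : Type*} [DecidableEq α] {a b j k : α} (hab : a ≠ b)
    (hjk : j ≠ k) : ∃ e : α ≃ α, e a = j ∧ e b = k := by
  have hb : Equiv.swap a j b ≠ j := fun h => hab
    ((Equiv.swap a j).injective ((Equiv.swap_apply_left a j).trans h.symm))
  refine ⟨(Equiv.swap a j).trans (Equiv.swap (Equiv.swap a j b) k), ?_, ?_⟩
  · rw [Equiv.trans_apply, Equiv.swap_apply_left, Equiv.swap_apply_of_ne_of_ne hb.symm hjk]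
  · rw [Equiv.trans_apply, Equiv.swap_apply_left]

end TwoFactors

namespace SymmOperad

variable {A : Type u} [Category.{v} A] [MonoidalCategory A] [SymmetricCategory A]
  {P : SymmOperad A}

/-- By equivariance, an operation kills a tensor product of morphisms as soon as it kills the
tensor product of the permuted family. -/
theorem Alg.tpowFamily_str_eq_zero_of_equiv [Preadditive A] (E : P.Alg) {X : A} {n : ℕ}
    (f : Fin n → (X ⟶ E.X)) (e : Fin n ≃ Fin n)
    (h : P.ops n ◁ tpowFamily (fun j => f (e j)) ≫ E.str n = 0) :
    P.ops n ◁ tpowFamily f ≫ E.str n = 0 := by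
  have h1 : P.act e ≫ P.act e.symm = 𝟙 (P.ops n) := by
    rw [← P.act_trans, Equiv.symm_trans_self, P.act_refl]
  have h2 := tpowFamily_perm e.symm (fun j => f (e j))
  simp only [Equiv.apply_symm_apply] at h2
  calc P.ops n ◁ tpowFamily f ≫ E.str n
      = (P.act e ≫ P.act e.symm) ▷ tpow X n ≫ P.ops n ◁ tpowFamily f ≫ E.str n := by
        rw [h1, id_whiskerRight, Category.id_comp]
    _ = P.act e ▷ tpow X n ≫ P.ops n ◁ (tpowFamily f ≫ tpowPerm E.X e.symm) ≫ E.str n := by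
        rw [comp_whiskerRight, Category.assoc, ← whisker_exchange_assoc, E.str_act,
          whiskerLeft_comp_assoc]
    _ = 0 := by
        rw [h2, whiskerLeft_comp_assoc, h, comp_zero, comp_zero]

end SymmOperad

namespace SymmOperad

variable {A : Type u} [Category.{v} A] [Abelian A] [MonoidalCategory A] [SymmetricCategory A]
  {P : SymmOperad A}

theorem peifferMap_eq (G : ReflexiveGraph P.Alg) (m : ℕ) :
    peifferMap G m =
      P.ops (2 + m) ◁ tensorPair (kernel.ι G.s.hom) (kernel.ι G.t.hom) (𝟙 G.E.X) m ≫
        G.E.str (2 + m) := by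
  rw [tensorPair, tpowMap_id, tensorHom_id]
  rfl

/-- Under the `Cat¹`-condition, operations vanish on an element of `ker s` and an element of
`ker t` at any two different places. -/
theorem IsCatOne.tpowFamily_str_eq_zero {G : ReflexiveGraph P.Alg} (hG : P.IsCatOne G) {X : A}
    {n : ℕ} (f : Fin n → (X ⟶ G.E.X)) {j k : Fin n} (hjk : j ≠ k) (hj : f j ≫ G.s.hom = 0)
    (hk : f k ≫ G.t.hom = 0) : P.ops n ◁ tpowFamily f ≫ G.E.str n = 0 := by
  obtain ⟨m, rfl⟩ : ∃ m, n = 2 + m := Nat.exists_eq_add_of_le (by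
    have := Fin.val_ne_of_ne hjk
    lia)
  obtain ⟨e, rfl, rfl⟩ := exists_equiv_apply_eq
    (show Fin.castAdd m (0 : Fin 2) ≠ Fin.castAdd m 1 from
      (Fin.castAdd_injective 2 m).ne zero_ne_one) hjk
  refine G.E.tpowFamily_str_eq_zero_of_equiv f e ?_
  rw [tpowFamily_eq_comp_tensorPair (kernel.ι G.s.hom) (kernel.ι G.t.hom) _
    (kernel.lift _ _ hj) (kernel.lift _ _ hk) (kernel.lift_ι _ _ _).symm
    (kernel.lift_ι _ _ _).symm, whiskerLeft_comp_assoc, whiskerLeft_comp_assoc, ← peifferMap_eq,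
    hG m, comp_zero, comp_zero]

variable [MonoidalPreadditive A]

theorem IsCatOne.str_eq_zero_of_mem {G : ReflexiveGraph P.Alg} (hG : P.IsCatOne G) {X : A}
    {x y : X ⟶ G.E.X} (hx : x ≫ G.s.hom = 0) (hy : y ≫ G.t.hom = 0) {n : ℕ}
    {w : tpow X n ⟶ tpow G.E.X n} (hw : w ∈ tensorsContainingBoth x y n) :
    P.ops n ◁ w ≫ G.E.str n = 0 := by
  induction hw using AddSubgroup.closure_induction with
  | mem w hw =>
    obtain ⟨f, j, k, hjk, rfl, rfl, rfl⟩ := hw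
    exact hG.tpowFamily_str_eq_zero f hjk hx hy
  | zero => rw [MonoidalPreadditive.whiskerLeft_zero, zero_comp]
  | add w w' _ _ h h' =>
    rw [MonoidalPreadditive.whiskerLeft_add, Preadditive.add_comp, h, h', add_zero]
  | neg w _ h =>
    have h1 : P.ops n ◁ (-w) = -(P.ops n ◁ w) := (tensorLeft (P.ops n)).map_neg
    rw [h1, Preadditive.neg_comp, h, neg_zero]

/-- Under the `Cat¹`-condition, `(g, f) ↦ g + f - i (s g)` is a morphism of algebras on the
composable pairs. -/
theorem IsCatOne.add_sub_comm_str {G : ReflexiveGraph P.Alg} (hG : P.IsCatOne G) {T : P.Alg}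
    (g f : T ⟶ G.E) (w : g ≫ G.s = f ≫ G.t) (n : ℕ) :
    P.ops n ◁ tpowMap (g.hom + f.hom - (g ≫ G.s ≫ G.i).hom) n ≫ G.E.str n =
      T.str n ≫ (g.hom + f.hom - (g ≫ G.s ≫ G.i).hom) := by
  -- On generalized elements, `g = e + x` and `f = e + y` with `e = i (s g) = i (t f)`, `s x = 0`
  -- and `t y = 0`, so that `g + f - e = e + x + y`.
  obtain ⟨e, he⟩ : ∃ e : T ⟶ G.E, e = g ≫ G.s ≫ G.i := ⟨_, rfl⟩
  have hx : (g.hom - e.hom) ≫ G.s.hom = 0 := by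
    rw [Preadditive.sub_comp, ← Alg.comp_hom, ← Alg.comp_hom, he, Category.assoc, Category.assoc,
      G.i_s, Category.comp_id, sub_self]
  have hy : (f.hom - e.hom) ≫ G.t.hom = 0 := by
    rw [Preadditive.sub_comp, ← Alg.comp_hom, ← Alg.comp_hom, he, Category.assoc, Category.assoc,
      G.i_t, Category.comp_id, w, sub_self]
  have key := hG.str_eq_zero_of_mem hx hy
    (tpowMap_sub_mem_tensorsContainingBoth e.hom (g.hom - e.hom) (f.hom - e.hom) n)
  have h1 (w w' : tpow T.X n ⟶ tpow G.E.X n) :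
      P.ops n ◁ (w - w') = P.ops n ◁ w - P.ops n ◁ w' := (tensorLeft (P.ops n)).map_sub
  rw [MonoidalPreadditive.whiskerLeft_add, h1, h1, Preadditive.add_comp, Preadditive.sub_comp,
    Preadditive.sub_comp, add_sub_cancel, add_sub_cancel, g.comm, f.comm, e.comm,
    ← add_sub_assoc] at key
  rw [← he, Preadditive.comp_sub, Preadditive.comp_add, ← sub_eq_zero, ← key]
  abel

end SymmOperad

/-! ### Internal categories and `Cat¹`-algebras -/

namespace SymmOperad

section Pullback

variable {A : Type u} [Category.{v} A] [MonoidalCategory A] [SymmetricCategory A]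
  {P : SymmOperad A} [HasPullbacks A]

/-- The forgetful functor to `A` preserves pullbacks, whichever pullback of algebras is chosen. -/
theorem Alg.isPullback_hom {E F B : P.Alg} (f : E ⟶ B) (g : F ⟶ B) :
    IsPullback (pullback.fst f g).hom (pullback.snd f g).hom f.hom g.hom := by
  let φ := (limit.isLimit (cospan f g)).conePointUniqueUpToIso (Alg.pullbackAlgIsLimit f g)
  have h1 : φ.hom ≫ Alg.pullbackAlgFst f g = pullback.fst f g :=
    (limit.isLimit (cospan f g)).conePointUniqueUpToIso_hom_comp _ WalkingCospan.left
  have h2 : φ.hom ≫ Alg.pullbackAlgSnd f g = pullback.snd f g :=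
    (limit.isLimit (cospan f g)).conePointUniqueUpToIso_hom_comp _ WalkingCospan.right
  let ψ : (pullback f g).X ≅ pullback f.hom g.hom :=
    ⟨φ.hom.hom, φ.inv.hom, congrArg Alg.Hom.hom φ.hom_inv_id, congrArg Alg.Hom.hom φ.inv_hom_id⟩
  refine IsPullback.of_iso_pullback ⟨?_⟩ ψ ?_ ?_
  · exact congrArg Alg.Hom.hom (pullback.condition (f := f) (g := g))
  · exact congrArg Alg.Hom.hom h1
  · exact congrArg Alg.Hom.hom h2

end Pullback

variable {A : Type u} [Category.{v} A] [Abelian A] [MonoidalCategory A] [SymmetricCategory A]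
  {P : SymmOperad A}

/-- Any composition is given by `g ∘ f = g + f - i (s g)`: as it is a linear map on the pairs,
this follows from `(g, f) = (g, i (s g)) + (i (t f), f) - (i (s g), i (s g))` and the unit laws. -/
theorem comp_hom_eq {G : ReflexiveGraph P.Alg} (S : InternalCategoryStructure G) :
    S.comp.hom = (pullback.fst G.s G.t).hom + (pullback.snd G.s G.t).hom -
      (pullback.fst G.s G.t ≫ G.s ≫ G.i).hom := by
  let π₁ := pullback.fst G.s G.t
  let π₂ := pullback.snd G.s G.t
  have hπ : π₁ ≫ G.s = π₂ ≫ G.t := pullback.condition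
  -- `r g = (g, i (s g))` and `l f = (i (t f), f)`
  let r : G.E ⟶ pullback G.s G.t := pullback.lift (𝟙 G.E) (G.s ≫ G.i)
    (by rw [Category.assoc, G.i_t, Category.comp_id, Category.id_comp])
  let l : G.E ⟶ pullback G.s G.t := pullback.lift (G.t ≫ G.i) (𝟙 G.E)
    (by rw [Category.assoc, G.i_s, Category.comp_id, Category.id_comp])
  have r_fst : r ≫ π₁ = 𝟙 _ := pullback.lift_fst _ _ _
  have r_snd : r ≫ π₂ = G.s ≫ G.i := pullback.lift_snd _ _ _
  have l_fst : l ≫ π₁ = G.t ≫ G.i := pullback.lift_fst _ _ _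
  have l_snd : l ≫ π₂ = 𝟙 _ := pullback.lift_snd _ _ _
  have decomp : 𝟙 (pullback G.s G.t).X =
      (π₁ ≫ r).hom + (π₂ ≫ l).hom - (π₁ ≫ G.s ≫ G.i ≫ r).hom := by
    apply (Alg.isPullback_hom G.s G.t).hom_ext
    · have h1 : (π₂ ≫ l) ≫ π₁ = (π₁ ≫ G.s ≫ G.i ≫ r) ≫ π₁ := by
        simp only [Category.assoc, l_fst, r_fst, Category.comp_id, ← reassoc_of% hπ]
      have h2 : (π₁ ≫ r) ≫ π₁ = π₁ := by rw [Category.assoc, r_fst, Category.comp_id]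
      rw [Preadditive.sub_comp, Preadditive.add_comp, ← Alg.comp_hom, ← Alg.comp_hom,
        ← Alg.comp_hom, h1, h2, add_sub_cancel_right, Category.id_comp]
    · have h1 : (π₁ ≫ G.s ≫ G.i ≫ r) ≫ π₂ = (π₁ ≫ r) ≫ π₂ := by
        simp only [Category.assoc, r_snd, reassoc_of% G.i_s]
      have h2 : (π₂ ≫ l) ≫ π₂ = π₂ := by rw [Category.assoc, l_snd, Category.comp_id]
      rw [Preadditive.sub_comp, Preadditive.add_comp, ← Alg.comp_hom, ← Alg.comp_hom,
        ← Alg.comp_hom, h1, h2, add_sub_cancel_left, Category.id_comp]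
  have h1 : (π₁ ≫ r) ≫ S.comp = π₁ := by
    rw [Category.assoc, S.comp_id, Category.comp_id]
  have h2 : (π₂ ≫ l) ≫ S.comp = π₂ := by
    rw [Category.assoc, S.id_comp, Category.comp_id]
  have h3 : (π₁ ≫ G.s ≫ G.i ≫ r) ≫ S.comp = π₁ ≫ G.s ≫ G.i := by
    simp only [Category.assoc, r, S.comp_id, Category.comp_id]
  rw [← Category.id_comp S.comp.hom, decomp, Preadditive.sub_comp, Preadditive.add_comp,
    ← Alg.comp_hom, ← Alg.comp_hom, ← Alg.comp_hom, h1, h2, h3]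

theorem subsingleton_internalCategoryStructure (G : ReflexiveGraph P.Alg) :
    Subsingleton (InternalCategoryStructure G) :=
  ⟨fun S S' => InternalCategoryStructure.ext
    (Alg.hom_ext ((comp_hom_eq S).trans (comp_hom_eq S').symm))⟩

theorem internalCategory_ext {X Y : InternalCategory P.Alg} (h : X.graph = Y.graph) : X = Y := by
  obtain ⟨G, S⟩ := X
  obtain ⟨H, S'⟩ := Y
  obtain rfl : G = H := h
  obtain rfl : S = S' := (subsingleton_internalCategoryStructure G).elim S S'
  rfl

theorem map_comp_of_graphHom {G H : ReflexiveGraph P.Alg} (S : InternalCategoryStructure G)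
    (S' : InternalCategoryStructure H) (φ : G ⟶ H) :
    S.comp ≫ φ.onE = pullback.map G.s G.t H.s H.t φ.onE φ.onE φ.onB φ.comm_s φ.comm_t ≫
      S'.comp := by
  have h1 : pullback.map G.s G.t H.s H.t φ.onE φ.onE φ.onB φ.comm_s φ.comm_t ≫
      pullback.fst H.s H.t = pullback.fst G.s G.t ≫ φ.onE := pullback.lift_fst _ _ _
  have h2 : pullback.map G.s G.t H.s H.t φ.onE φ.onE φ.onB φ.comm_s φ.comm_t ≫
      pullback.snd H.s H.t = pullback.snd G.s G.t ≫ φ.onE := pullback.lift_snd _ _ _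
  have h3 : (pullback.fst G.s G.t ≫ G.s ≫ G.i) ≫ φ.onE =
      (pullback.fst G.s G.t ≫ φ.onE) ≫ H.s ≫ H.i := by
    simp only [Category.assoc, φ.comm_i, reassoc_of% φ.comm_s]
  ext
  rw [Alg.comp_hom, Alg.comp_hom, comp_hom_eq, comp_hom_eq, Preadditive.sub_comp,
    Preadditive.add_comp, Preadditive.comp_sub, Preadditive.comp_add, ← Alg.comp_hom,
    ← Alg.comp_hom, ← Alg.comp_hom, ← Alg.comp_hom, ← Alg.comp_hom, ← Alg.comp_hom, h3,
    ← Category.assoc (pullback.map _ _ _ _ _ _ _ _ _), h1, h2]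

variable [MonoidalPreadditive A]

/-- If `x ∈ ker s` and `y ∈ ker t`, then `x = x ∘ 0` and `y = 0 ∘ y`, so that an operation takes
the same value on `x`, `y`, … and on the composable pairs `(x, 0)`, `(0, y)`, …; on these it
vanishes, because it does so in both components. -/
theorem isCatOne_of_internalCategoryStructure {G : ReflexiveGraph P.Alg}
    (S : InternalCategoryStructure G) : P.IsCatOne G := by
  intro m
  have pb := Alg.isPullback_hom G.s G.t
  -- `u x = (x, 0)`, `v y = (0, y)` and `r z = (z, i (s z))`
  let u : kernel G.s.hom ⟶ (pullback G.s G.t).X :=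
    pb.lift (kernel.ι G.s.hom) 0 (by rw [kernel.condition, zero_comp])
  let v : kernel G.t.hom ⟶ (pullback G.s G.t).X :=
    pb.lift 0 (kernel.ι G.t.hom) (by rw [kernel.condition, zero_comp])
  let r : G.E ⟶ pullback G.s G.t := pullback.lift (𝟙 G.E) (G.s ≫ G.i)
    (by rw [Category.assoc, G.i_t, Category.comp_id, Category.id_comp])
  have u_fst : u ≫ (pullback.fst G.s G.t).hom = kernel.ι G.s.hom := pb.lift_fst _ _ _
  have u_snd : u ≫ (pullback.snd G.s G.t).hom = 0 := pb.lift_snd _ _ _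
  have v_fst : v ≫ (pullback.fst G.s G.t).hom = 0 := pb.lift_fst _ _ _
  have v_snd : v ≫ (pullback.snd G.s G.t).hom = kernel.ι G.t.hom := pb.lift_snd _ _ _
  have u_comp : u ≫ S.comp.hom = kernel.ι G.s.hom := by
    rw [comp_hom_eq, Preadditive.comp_sub, Preadditive.comp_add, Alg.comp_hom, Alg.comp_hom,
      reassoc_of% u_fst, kernel.condition_assoc, u_fst, u_snd, zero_comp, add_zero, sub_zero]
  have v_comp : v ≫ S.comp.hom = kernel.ι G.t.hom := by
    rw [comp_hom_eq, Preadditive.comp_sub, Preadditive.comp_add, Alg.comp_hom,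
      reassoc_of% v_fst, v_fst, v_snd, zero_comp, zero_add, sub_zero]
  have r_comp : r.hom ≫ S.comp.hom = 𝟙 G.E.X := congrArg Alg.Hom.hom S.comp_id
  have hzero : P.ops (2 + m) ◁ tensorPair u v r.hom m ≫ (pullback G.s G.t).str (2 + m) = 0 := by
    apply pb.hom_ext
    · rw [Category.assoc, ← (pullback.fst G.s G.t).comm, ← whiskerLeft_comp_assoc,
        tensorPair_comp, v_fst, tensorPair]
      simp
    · rw [Category.assoc, ← (pullback.snd G.s G.t).comm, ← whiskerLeft_comp_assoc,
        tensorPair_comp, u_snd, tensorPair]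
      simp
  rw [peifferMap_eq, ← u_comp, ← v_comp, ← r_comp, ← tensorPair_comp, whiskerLeft_comp_assoc,
    S.comp.comm, reassoc_of% hzero, zero_comp]

/-- The composition `g ∘ f = g + f - i (s g)` on a reflexive graph that satisfies the
`Cat¹`-condition. -/
noncomputable def IsCatOne.comp {G : ReflexiveGraph P.Alg} (hG : P.IsCatOne G) :
    pullback G.s G.t ⟶ G.E :=
  Alg.Hom.mk _ (hG.add_sub_comm_str (pullback.fst G.s G.t) (pullback.snd G.s G.t)
    pullback.condition)

theorem IsCatOne.lift_comp_hom {G : ReflexiveGraph P.Alg} (hG : P.IsCatOne G) {T : P.Alg}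
    (g f : T ⟶ G.E) (w : g ≫ G.s = f ≫ G.t) :
    (pullback.lift g f w ≫ hG.comp).hom = g.hom + f.hom - g.hom ≫ G.s.hom ≫ G.i.hom := by
  have h1 : (pullback.lift g f w).hom ≫ (pullback.fst G.s G.t).hom = g.hom :=
    congrArg Alg.Hom.hom (pullback.lift_fst g f w)
  have h2 : (pullback.lift g f w).hom ≫ (pullback.snd G.s G.t).hom = f.hom :=
    congrArg Alg.Hom.hom (pullback.lift_snd g f w)
  rw [IsCatOne.comp, Alg.comp_hom, Preadditive.comp_sub, Preadditive.comp_add, h1, h2,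
    Alg.comp_hom, Alg.comp_hom, reassoc_of% h1]

/-- The internal category with composition `g ∘ f = g + f - i (s g)`; its axioms are identities
between linear maps in `A`. -/
noncomputable def IsCatOne.internalCategoryStructure {G : ReflexiveGraph P.Alg}
    (hG : P.IsCatOne G) : InternalCategoryStructure G :=
  have i_s : G.i.hom ≫ G.s.hom = 𝟙 _ := congrArg Alg.Hom.hom G.i_s
  have i_t : G.i.hom ≫ G.t.hom = 𝟙 _ := congrArg Alg.Hom.hom G.i_t
  have cond : (pullback.fst G.s G.t).hom ≫ G.s.hom = (pullback.snd G.s G.t).hom ≫ G.t.hom :=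
    congrArg Alg.Hom.hom (pullback.condition (f := G.s) (g := G.t))
  { comp := hG.comp
    comp_s := by
      ext
      simp [IsCatOne.comp, Preadditive.sub_comp, i_s]
    comp_t := by
      ext
      simp [IsCatOne.comp, Preadditive.sub_comp, i_t, cond]
    comp_id := by
      ext
      rw [hG.lift_comp_hom]
      simp
    id_comp := by
      ext
      rw [hG.lift_comp_hom]
      simp [reassoc_of% i_s]
    assoc := fun h g f w₁ w₂ => by
      ext
      rw [hG.lift_comp_hom, hG.lift_comp_hom, hG.lift_comp_hom, hG.lift_comp_hom]
      simp only [Preadditive.sub_comp, Preadditive.add_comp, Category.assoc, reassoc_of% i_s]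
      abel }

/-- The functor that equips a `Cat¹`-algebra with its unique internal category structure. -/
noncomputable def catOneToInternalCategory (P : SymmOperad A) :
    P.CatOne ⥤ InternalCategory P.Alg where
  obj G := ⟨G.obj, IsCatOne.internalCategoryStructure G.property⟩
  map φ := ⟨φ.hom, map_comp_of_graphHom _ _ φ.hom⟩

/-- The functor that forgets the composition, with values in the `Cat¹`-algebras. -/
def internalCategoryToCatOne (P : SymmOperad A) : InternalCategory P.Alg ⥤ P.CatOne :=
  P.IsCatOne.lift (InternalCategory.forget P.Alg)
    fun X => isCatOne_of_internalCategoryStructure X.str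

/-- `Cat¹`-algebras and internal categories are the same reflexive graphs, with the same
morphisms. -/
noncomputable def catOneIsoInternalCategory (P : SymmOperad A) :
    IsoCat P.CatOne (InternalCategory P.Alg) where
  functor := catOneToInternalCategory P
  inverse := internalCategoryToCatOne P
  unit_eq := rfl
  counit_eq := by
    refine CategoryTheory.Functor.ext (fun X => internalCategory_ext rfl) fun X Y φ => ?_
    -- The identifications of objects are identities of graphs, so they become visible as such
    -- after forgetting the compositions.
    have : (InternalCategory.forget P.Alg).Faithful := ⟨fun h => InternalCategory.Hom.ext h⟩
    apply (InternalCategory.forget P.Alg).map_injective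
    rw [Functor.map_comp, Functor.map_comp, eqToHom_map, eqToHom_map]
    exact ((Category.id_comp _).trans (Category.comp_id _)).symm

end SymmOperad

theorem mainTheorem3 {A : Type u} [Category.{v} A] [Abelian A] [HasLimits A] [HasColimits A]
    [MonoidalCategory A] [SymmetricCategory A] [MonoidalClosed A]
    (P : SymmOperad A) (hP : P.IsReduced) :
    (∀ G : ReflexiveGraph P.Alg,
      Subsingleton (InternalCategoryStructure G) ∧
        (Nonempty (InternalCategoryStructure G) ↔ P.IsCatOne G)) ∧
      ∃ Φ : IsoCat P.CatOne (InternalCategory P.Alg),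
        Φ.functor ⋙ InternalCategory.forget P.Alg = P.IsCatOne.ι ∧
          Φ.inverse ⋙ P.IsCatOne.ι = InternalCategory.forget P.Alg := by
  have : MonoidalPreadditive A := monoidalPreadditive_of_monoidalClosed
  exact ⟨fun G => ⟨SymmOperad.subsingleton_internalCategoryStructure G,
    fun ⟨S⟩ => SymmOperad.isCatOne_of_internalCategoryStructure S,
    fun hG => ⟨SymmOperad.IsCatOne.internalCategoryStructure hG⟩⟩,
    SymmOperad.catOneIsoInternalCategory P, rfl, rfl⟩
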